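/- Let $|GHZ_n\rangle=\frac{1}{\sqrt2}\big(|0\rangle^{\otimes n}+|1\rangle^{\otimes n}\big)$ be the GHZ state of $n$ qubits, and let $A,B,C$ be pairwise disjoint non-empty sets of its qubits (so $n\ge 3$; $A\cup B\cup C$ may or may not be the set of all the qubits). For a set $R$ of qubits let $S_R=-\mathrm{Tr}(\rho_R\ln\rho_R)$ be the von Neumann entropy of the reduced state $\rho_R$ of $|GHZ_n\rangle\langle GHZ_n|$, and let $I(X:Y)=S_X+S_Y-S_{XY}$, where $XY$ stands for $X\cup Y$. For pairwise disjoint sets $A_1,\dots,A_k$ of qubits let $$E_p^{(k)}(A_1:\cdots:A_k)=\min_{|\psi\rangle_{A_1\tilde A_1\cdots A_k\tilde A_k}}\big[S_{A_1\tilde A_1}+\cdots+S_{A_k\tilde A_k}\big]$$ be the multipartite entanglement of purification, the minimum being over all purifications $|\psi\rangle$ of $\rho_{A_1\cdots A_k}$ with ancillas $\tilde A_1,\dots,\tilde A_k$ of arbitrary finite dimensions. Let $$\Delta_p^{(3)}(A:B:C)=E_p^{(3)}(A:B:C)-\tfrac12\big[E_p^{(2)}(A:BC)+E_p^{(2)}(B:AC)+E_p^{(2)}(C:AB)\big].$$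 Then: (1) $S_A=S_B=S_C=S_{AB}=S_{BC}=S_{CA}=\ln 2$; moreover $S_{ABC}=\ln 2$ if $A\cup B\cup C$ is not the set of all the qubits, and $S_{ABC}=0$ if it is. (2) The bounds $$\min\{S_A+S_B+S_{AB},\,S_B+S_C+S_{BC},\,S_A+S_C+S_{AC}\}\quad\text{and}\quad\max\{S_A+S_B+S_C-S_{ABC},\,2(S_A+S_B+S_C)-S_{AB}-S_{BC}-S_{CA}\}$$ on $E_p^{(3)}(A:B:C)$ are both equal to $3\ln 2$, and the bounds $2\min\{S_A,S_{BC}\}$ and $I(A:B)+I(A:C)$ on $E_p^{(2)}(A:BC)$ are both equal to $2\ln 2$. (3) The minima that define the following quantities are attained, and $$E_p^{(3)}(A:B:C)=3\ln 2,\qquad E_p^{(2)}(A:BC)=E_p^{(2)}(B:AC)=E_p^{(2)}(C:AB)=2\ln 2 .$$ (4) $\Delta_p^{(3)}(A:B:C)=0$. -/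

import Mathlib

noncomputable section

namespace GHZPurification

/-! Finite quantum systems.  A system with sites `v : V` and local Hilbert spaces `ℂ^(d v)` has
Hilbert space `⨂ v, ℂ^(d v)`, whose product basis is indexed by `∀ v, d v`.  Vectors are functions
on that index set and density operators are matrices over it. -/

/-- The operator `|ψ⟩⟨ψ|`. -/
def pureState {X : Type*} (ψ : X → ℂ) : Matrix X X ℂ :=
  Matrix.vecMulVec ψ (star ψ)

/-- The von Neumann entropy `S(ρ) = -Tr (ρ ln ρ) = -∑ λ ln λ`, the sum being over the eigenvalues
of `ρ` with multiplicity (with the value `0` on matrices that are not Hermitian). -/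
def vonNeumannEntropy {X : Type*} [Fintype X] [DecidableEq X] (ρ : Matrix X X ℂ) : ℝ :=
  open Classical in
  if h : ρ.IsHermitian then ∑ i, Real.negMulLog (h.eigenvalues i) else 0

theorem exists_mem_of_mem_biUnion {V ι : Type*} [DecidableEq V] [Fintype ι] {A : ι → Finset V}
    (v : {v // v ∈ Finset.univ.biUnion A}) :
    ∃ i, (v : V) ∈ A i := by
  obtain ⟨i, _, hi⟩ := Finset.mem_biUnion.1 v.2
  exact ⟨i, hi⟩

section Regions

variable {V : Type*} [Fintype V] [DecidableEq V]
  {d : V → Type*} [∀ v, Fintype (d v)] [∀ v, DecidableEq (d v)]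

/-- The configuration of all the sites given by `x` on the region `R` and by `y` outside it. -/
def glue (R : Finset V) (x : ∀ v : {v // v ∈ R}, d v) (y : ∀ v : {v // v ∉ R}, d v) :
    ∀ v, d v :=
  (Equiv.piEquivPiSubtypeProd (fun v => v ∈ R) d).symm (x, y)

/-- The reduced density matrix `ρ_R`: the partial trace of `ρ` over the sites outside `R`. -/
def reducedState (R : Finset V) (ρ : Matrix (∀ v, d v) (∀ v, d v) ℂ) :
    Matrix (∀ v : {v // v ∈ R}, d v) (∀ v : {v // v ∈ R}, d v) ℂ :=
  fun x x' => ∑ y : (∀ v : {v // v ∉ R}, d v), ρ (glue R x y) (glue R x' y)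

/-- The entropy `S_R` of a region `R`. -/
def regionEntropy (ρ : Matrix (∀ v, d v) (∀ v, d v) ℂ) (R : Finset V) : ℝ :=
  vonNeumannEntropy (reducedState R ρ)

/-- The mutual information `I(A:B) = S_A + S_B - S_{AB}`. -/
def mutualInformation (ρ : Matrix (∀ v, d v) (∀ v, d v) ℂ) (A B : Finset V) : ℝ :=
  regionEntropy ρ A + regionEntropy ρ B - regionEntropy ρ (A ∪ B)

variable {ι : Type*} [Fintype ι] [DecidableEq ι]

/-- The configuration of the union of the regions `A i` obtained by joining configurations of the
single regions.  For pairwise disjoint regions this is the identification of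
`⨂ i, ⨂ v ∈ A i, ℂ^(d v)` with `⨂ v ∈ ⋃ i, A i, ℂ^(d v)`. -/
def joinRegions (A : ι → Finset V) (x : ∀ i, ∀ v : {v // v ∈ A i}, d v) :
    ∀ v : {v // v ∈ Finset.univ.biUnion A}, d v :=
  fun v => x (exists_mem_of_mem_biUnion v).choose ⟨v, (exists_mem_of_mem_biUnion v).choose_spec⟩

/-- The reduced state `ρ_{A₁⋯A_k}` of pairwise disjoint regions, as a `k`-partite state whose
`i`-th party has the Hilbert space `⨂ v ∈ A i, ℂ^(d v)`. -/
def multipartiteState (ρ : Matrix (∀ v, d v) (∀ v, d v) ℂ) (A : ι → Finset V) :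
    Matrix (∀ i, ∀ v : {v // v ∈ A i}, d v) (∀ i, ∀ v : {v // v ∈ A i}, d v) ℂ :=
  (reducedState (Finset.univ.biUnion A) ρ).submatrix (joinRegions A) (joinRegions A)

end Regions

section MEoP

variable {ι : Type*} [Fintype ι] [DecidableEq ι]
  {H : ι → Type*} [∀ i, Fintype (H i)] [∀ i, DecidableEq (H i)]

/-- `|ψ⟩` is a purification of the multipartite state `ρ`, where party `i` has received an ancilla
of dimension `m i`: tracing out all the ancillas of `|ψ⟩⟨ψ|` gives `ρ`. -/
def IsPurification (ρ : Matrix (∀ i, H i) (∀ i, H i) ℂ) (m : ι → ℕ)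
    (ψ : (∀ i, H i × Fin (m i)) → ℂ) : Prop :=
  ∀ x x' : ∀ i, H i,
    ∑ a : (∀ i, Fin (m i)), pureState ψ (fun i => (x i, a i)) (fun i => (x' i, a i)) = ρ x x'

/-- The values of `∑ i, S(Aᵢ Ãᵢ)` over all the purifications of `ρ`, with ancillas of all finite
dimensions. -/
def purificationValues (ρ : Matrix (∀ i, H i) (∀ i, H i) ℂ) : Set ℝ :=
  {s | ∃ (m : ι → ℕ) (ψ : (∀ i, H i × Fin (m i)) → ℂ),
    IsPurification ρ m ψ ∧ s = ∑ i, regionEntropy (pureState ψ) {i}}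

/-- The multipartite entanglement of purification of `ρ`. -/
def multipartiteEoP (ρ : Matrix (∀ i, H i) (∀ i, H i) ℂ) : ℝ :=
  sInf (purificationValues ρ)

end MEoP

section Signal

variable {V : Type*} [Fintype V] [DecidableEq V]
  {d : V → Type*} [∀ v, Fintype (d v)] [∀ v, DecidableEq (d v)]

/-- `E_p^{(2)}(A:B)`. -/
def Ep2 (ρ : Matrix (∀ v, d v) (∀ v, d v) ℂ) (A B : Finset V) : ℝ :=
  multipartiteEoP (multipartiteState ρ ![A, B])

/-- `E_p^{(3)}(A:B:C)`. -/
def Ep3 (ρ : Matrix (∀ v, d v) (∀ v, d v) ℂ) (A B C : Finset V) : ℝ :=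
  multipartiteEoP (multipartiteState ρ ![A, B, C])

/-- The tripartite entanglement signal `Δ_p^{(3)}(A:B:C)`. -/
def Delta3 (ρ : Matrix (∀ v, d v) (∀ v, d v) ℂ) (A B C : Finset V) : ℝ :=
  Ep3 ρ A B C - 1 / 2 * (Ep2 ρ A (B ∪ C) + Ep2 ρ B (A ∪ C) + Ep2 ρ C (A ∪ B))

end Signal

/-- The vector `|GHZ_n⟩ = (|0⟩^{⊗n} + |1⟩^{⊗n}) / √2` of `n` qubits. -/
def ghzVector (n : ℕ) : (Fin n → Fin 2) → ℂ :=
  ((1 / √2 : ℝ) : ℂ) • (Pi.single (fun _ => 0) 1 + Pi.single (fun _ => 1) 1)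

/-- The density matrix `|GHZ_n⟩⟨GHZ_n|`. -/
def ghzState (n : ℕ) : Matrix (Fin n → Fin 2) (Fin n → Fin 2) ℂ :=
  pureState (ghzVector n)

end GHZPurification

end

/-!
Both the GHZ state and its optimal purifications are equal superpositions `(|c₀⟩ + |c₁⟩) / √2` of
two configurations.  Tracing out part of such a vector leaves the equal mixture of the two
remaining configurations if the discarded parts of `c₀` and `c₁` differ (`partialTrace_mixture`),
and a pure superposition of the same form if they agree (`partialTrace_pure`).  The mixture has
entropy `ln 2` and the pure state has entropy `0`; this gives all the entropies of regions, and
identifies the reduced state of disjoint non-empty regions (`multipartiteState_ghzState`).  It is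
purified by a superposition of the same form, in which every party has entropy `ln 2`: the ancillas
carry a copy of the classical bit when the reduced state is mixed, and are in a fixed state when it
is pure.

For the lower bound, let `ψ` be any purification of a state with the populations of the GHZ state
(`log_two_le_regionEntropy_of_isPurification`).  In `ψ` the system part of any party is `e₀` or
`e₁`, and all the parties agree on which.  Since another party knows the bit, the reduced state of
a party with its ancilla is block diagonal in the bit, and each block has trace `1/2`.  So its
eigenvalues are at most `1/2`, and its entropy is at least `ln 2`
(`eigenvalues_le_of_blockDiagonal`, `neg_log_le_vonNeumannEntropy`).  Summed over `k` parties, the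
bound `k ln 2` is the value of the purification above.
-/

namespace GHZPurification

open Matrix
open scoped ComplexOrder

/-! ### Von Neumann entropy -/

section Entropy

variable {X : Type*} [Fintype X] [DecidableEq X]

theorem vonNeumannEntropy_of_isHermitian {ρ : Matrix X X ℂ} (h : ρ.IsHermitian) :
    vonNeumannEntropy ρ = ∑ i, Real.negMulLog (h.eigenvalues i) :=
  dif_pos h

theorem vonNeumannEntropy_diagonal (f : X → ℝ) :
    vonNeumannEntropy (diagonal fun x => (f x : ℂ)) = ∑ x, Real.negMulLog (f x) := by
  have h : (diagonal fun x => (f x : ℂ)).IsHermitian :=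
    isHermitian_diagonal_of_self_adjoint _ (by ext x; simp)
  rw [vonNeumannEntropy_of_isHermitian h]
  have hroots := h.roots_charpoly_eq_eigenvalues
  rw [charpoly_diagonal, Polynomial.roots_prod _ _
    (Finset.prod_ne_zero_iff.2 fun x _ => Polynomial.X_sub_C_ne_zero _)] at hroots
  have := congrArg (fun s : Multiset ℂ => (s.map fun z => Real.negMulLog z.re).sum) hroots
  simpa [Multiset.map_map] using this.symm

/-- The eigenvalues of a projection are `0` and `1`, where `negMulLog` vanishes. -/
theorem vonNeumannEntropy_eq_zero_of_isIdempotentElem {ρ : Matrix X X ℂ} (h : ρ.IsHermitian)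
    (hρ : IsIdempotentElem ρ) : vonNeumannEntropy ρ = 0 := by
  rw [vonNeumannEntropy_of_isHermitian h]
  refine Finset.sum_eq_zero fun i _ => ?_
  have := hρ.spectrum_subset ℝ (h.eigenvalues_mem_spectrum_real i)
  rcases this with h0 | h1
  · simp [h0]
  · simp [Set.mem_singleton_iff.1 h1]

theorem neg_log_le_vonNeumannEntropy {ρ : Matrix X X ℂ} (h : ρ.PosSemidef) (htr : ρ.trace = 1)
    {c : ℝ} (hc : ∀ i, h.1.eigenvalues i ≤ c) : -Real.log c ≤ vonNeumannEntropy ρ := by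
  have hsum : ∑ i, h.1.eigenvalues i = 1 := by
    have := h.1.trace_eq_sum_eigenvalues
    rw [htr] at this
    exact Complex.ofReal_injective (by simpa using this.symm)
  rw [vonNeumannEntropy_of_isHermitian h.1]
  calc -Real.log c = ∑ i, h.1.eigenvalues i * -Real.log c := by
        rw [← Finset.sum_mul, hsum, one_mul]
    _ ≤ _ := Finset.sum_le_sum fun i _ => ?_
  rcases (h.eigenvalues_nonneg i).eq_or_lt with h0 | h0
  · simp [← h0]
  · have := mul_le_mul_of_nonneg_left (Real.log_le_log h0 (hc i)) h0.le
    rw [Real.negMulLog]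
    linarith

/-- If a positive semidefinite matrix is block diagonal, then the restriction of an eigenvector to
a block on which it does not vanish is an eigenvector of that block, so that the eigenvalue is at
most the trace of the block. -/
theorem eigenvalues_le_of_blockDiagonal {Y : Type*} [DecidableEq Y] {ρ : Matrix X X ℂ}
    (h : ρ.PosSemidef) (f : X → Y) (hoff : ∀ x x', f x ≠ f x' → ρ x x' = 0) {c : ℝ}
    (htr : ∀ y, ∑ x with f x = y, (ρ x x).re ≤ c) (i : X) : h.1.eigenvalues i ≤ c := by
  set v : X → ℂ := ⇑(h.1.eigenvectorBasis i) with hv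
  have hne : v ≠ 0 := fun h0 => h.1.eigenvectorBasis.orthonormal.ne_zero i (by
    ext x; exact congrFun h0 x)
  obtain ⟨x₀, hx₀⟩ := Function.ne_iff.1 hne
  let B : Matrix {x // f x = f x₀} {x // f x = f x₀} ℂ := ρ.submatrix Subtype.val Subtype.val
  have hB : B.PosSemidef := h.submatrix _
  have heig : toLin' B (fun x => v x.1) = (h.1.eigenvalues i : ℂ) • fun x => v x.1 := by
    ext x
    have hx := congrFun (h.1.mulVec_eigenvectorBasis i) x
    rw [← hv] at hx
    simp only [Pi.smul_apply, mulVec, dotProduct, Complex.real_smul] at hx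
    simp only [toLin'_apply, mulVec, dotProduct, Pi.smul_apply, smul_eq_mul, ← hx, B,
      submatrix_apply]
    rw [← Finset.sum_subtype {x' | f x' = f x₀} (by simp) fun x' => ρ x x' * v x']
    refine Finset.sum_filter_of_ne fun x' _ hx' => ?_
    by_contra hne
    exact left_ne_zero_of_mul hx' (hoff _ _ fun h => hne (h.symm.trans x.2))
  have hmem : (h.1.eigenvalues i : ℂ) ∈ spectrum ℂ B := by
    rw [← spectrum_toLin']
    refine (Module.End.hasEigenvalue_of_hasEigenvector
      (Module.End.hasEigenvector_iff.2 ⟨Module.End.mem_eigenspace_iff.2 heig, ?_⟩)).mem_spectrum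
    exact Function.ne_iff.2 ⟨⟨x₀, rfl⟩, hx₀⟩
  obtain ⟨_, ⟨j, rfl⟩, hj⟩ := hB.1.spectrum_eq_image_range ▸ hmem
  have hj : hB.1.eigenvalues j = h.1.eigenvalues i := Complex.ofReal_injective hj
  calc h.1.eigenvalues i = hB.1.eigenvalues j := hj.symm
    _ ≤ ∑ k, hB.1.eigenvalues k :=
      Finset.single_le_sum (fun k _ => hB.eigenvalues_nonneg k) (Finset.mem_univ j)
    _ = B.trace.re := by simp [hB.1.trace_eq_sum_eigenvalues]
    _ = ∑ x with f x = f x₀, (ρ x x).re := by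
      simp only [trace, diag_apply, B, submatrix_apply, Complex.re_sum]
      exact Finset.sum_subtype _ (by simp) (fun x => (ρ x x).re) |>.symm
    _ ≤ c := htr _

end Entropy

/-! ### Superpositions and mixtures of two configurations -/

section Cat

variable {X Y Z : Type*} [DecidableEq X] [DecidableEq Y] [DecidableEq Z]

/-- The superposition `(|c 0⟩ + |c 1⟩) / √2`.  It is a unit vector if `c 0 ≠ c 1`. -/
noncomputable def catVector (c : Fin 2 → Z) : Z → ℂ :=
  ((1 / √2 : ℝ) : ℂ) • (Pi.single (c 0) 1 + Pi.single (c 1) 1)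

/-- The mixture `(|c 0⟩⟨c 0| + |c 1⟩⟨c 1|) / 2`. -/
noncomputable def catMixture (c : Fin 2 → Z) : Matrix Z Z ℂ :=
  diagonal fun z => ((((if z = c 0 then 1 else 0) + (if z = c 1 then 1 else 0)) / 2 : ℝ) : ℂ)

theorem pureState_catVector_apply (c : Fin 2 → Z) (z z' : Z) :
    pureState (catVector c) z z' =
      ((if z = c 0 then 1 else 0) + (if z = c 1 then 1 else 0)) *
        ((if z' = c 0 then 1 else 0) + (if z' = c 1 then 1 else 0)) / 2 := by
  have h : ((√2 : ℝ) : ℂ) * ((√2 : ℝ) : ℂ) = 2 := by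
    rw [← Complex.ofReal_mul, Real.mul_self_sqrt (by norm_num)]; norm_num
  have h' : ((√2 : ℝ) : ℂ)⁻¹ * ((√2 : ℝ) : ℂ)⁻¹ = 1 / 2 := by
    rw [← mul_inv, h, one_div]
  simp only [pureState, vecMulVec_apply, catVector, Pi.smul_apply, Pi.add_apply, Pi.single_apply,
    Pi.star_apply, smul_eq_mul, star_mul', star_add, one_div, Complex.ofReal_inv]
  have hs : star (((√2 : ℝ) : ℂ)⁻¹) = ((√2 : ℝ) : ℂ)⁻¹ := by simp
  have hite (P : Prop) [Decidable P] :
      star (if P then (1 : ℂ) else 0) = if P then 1 else 0 := by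
    split_ifs <;> simp
  rw [hs, hite, hite]
  linear_combination ((if z = c 0 then 1 else 0) + (if z = c 1 then 1 else 0)) *
    ((if z' = c 0 then 1 else 0) + (if z' = c 1 then 1 else 0)) * h'

theorem pureState_catVector_comp (c : Fin 2 → X) {j : X → Z} (hj : Function.Injective j) :
    (pureState (catVector fun s => j (c s))).submatrix j j = pureState (catVector c) := by
  ext x x'
  simp [pureState_catVector_apply, hj.eq_iff]

theorem catMixture_comp (c : Fin 2 → X) {j : X → Z} (hj : Function.Injective j) :
    (catMixture fun s => j (c s)).submatrix j j = catMixture c := by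
  ext x x'
  simp [catMixture, diagonal_apply, hj.eq_iff]

theorem pureState_catVector_diag {c : Fin 2 → Z} (hc : c 0 ≠ c 1) (z : Z) :
    pureState (catVector c) z z = catMixture c z z := by
  rw [pureState_catVector_apply, catMixture, diagonal_apply_eq]
  split_ifs <;> simp_all

/-- Here `j x y` is the configuration composed of `x` and `y`; tracing out `y`, which distinguishes
the two terms of the superposition, destroys the coherence. -/
theorem partialTrace_mixture [Fintype Y] (j : X → Y → Z) {c : Fin 2 → Z} {p : Fin 2 → X}
    {q : Fin 2 → Y} (hj : ∀ s x y, j x y = c s ↔ x = p s ∧ y = q s) (hq : q 0 ≠ q 1) (x x' : X) :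
    ∑ y, pureState (catVector c) (j x y) (j x' y) = catMixture p x x' := by
  have key (y : Y) : pureState (catVector c) (j x y) (j x' y) =
      (if y = q 0 then (if x = p 0 then 1 else 0) * (if x' = p 0 then 1 else 0) / 2 else 0) +
      (if y = q 1 then (if x = p 1 then 1 else 0) * (if x' = p 1 then 1 else 0) / 2 else 0) := by
    rw [pureState_catVector_apply]
    simp only [hj]
    by_cases h0 : y = q 0
    · simp [h0, hq]
    · by_cases h1 : y = q 1 <;> simp [h0, h1, hq.symm]
  simp only [key, Finset.sum_add_distrib, Finset.sum_ite_eq', Finset.mem_univ, if_true]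
  rw [catMixture, diagonal_apply]
  by_cases h : x = x'
  · subst h
    rw [if_pos rfl]
    split_ifs <;> norm_num
  · rw [if_neg h]
    have (s : Fin 2) : (if x = p s then (1 : ℂ) else 0) * (if x' = p s then 1 else 0) = 0 := by
      split_ifs with h1 h2 <;> simp
      exact h (h1.trans h2.symm)
    simp [this]

/-- Tracing out `y` keeps the coherence if `y` does not distinguish the two terms. -/
theorem partialTrace_pure [Fintype Y] (j : X → Y → Z) {c : Fin 2 → Z} {p : Fin 2 → X}
    {q : Fin 2 → Y} (hj : ∀ s x y, j x y = c s ↔ x = p s ∧ y = q s) (hq : q 0 = q 1) (x x' : X) :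
    ∑ y, pureState (catVector c) (j x y) (j x' y) = pureState (catVector p) x x' := by
  have key (y : Y) : pureState (catVector c) (j x y) (j x' y) =
      if y = q 1 then pureState (catVector p) x x' else 0 := by
    simp only [pureState_catVector_apply, hj, hq]
    by_cases h0 : y = q 1 <;> simp [h0]
  simp [key]

theorem vonNeumannEntropy_catMixture [Fintype Z] {c : Fin 2 → Z} (hc : c 0 ≠ c 1) :
    vonNeumannEntropy (catMixture c) = Real.log 2 := by
  rw [catMixture, vonNeumannEntropy_diagonal, Fintype.sum_eq_add (c 0) (c 1) hc]
  · simp [hc, hc.symm, Real.negMulLog]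
    ring
  · rintro z ⟨h0, h1⟩
    simp [h0, h1]

theorem vonNeumannEntropy_pureState_catVector [Fintype Z] {c : Fin 2 → Z} (hc : c 0 ≠ c 1) :
    vonNeumannEntropy (pureState (catVector c)) = 0 := by
  refine vonNeumannEntropy_eq_zero_of_isIdempotentElem
    (posSemidef_vecMulVec_self_star _).1 ?_
  have hnorm : star (catVector c) ⬝ᵥ catVector c = 1 := by
    calc star (catVector c) ⬝ᵥ catVector c = ∑ z, pureState (catVector c) z z := by
          simp [dotProduct, pureState, vecMulVec_apply, mul_comm]
      _ = 1 := by
          simp only [pureState_catVector_diag hc, catMixture, diagonal_apply_eq]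
          rw [← Complex.ofReal_sum, ← Finset.sum_div]
          simp [Finset.sum_add_distrib]
  change pureState (catVector c) * pureState (catVector c) = pureState (catVector c)
  rw [pureState, vecMulVec_mul_vecMulVec, hnorm, one_smul]

end Cat

/-! ### Entropies of regions -/

section Regions

variable {V : Type*} [DecidableEq V] {d : V → Type*}

theorem glue_eq_iff (R : Finset V) (x : ∀ v : {v // v ∈ R}, d v) (y : ∀ v : {v // v ∉ R}, d v)
    (z : ∀ v, d v) : glue R x y = z ↔
      (x = fun v : {v // v ∈ R} => z v.1) ∧ y = fun v : {v // v ∉ R} => z v.1 := by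
  rw [glue, Equiv.symm_apply_eq, Prod.ext_iff]
  rfl

variable [Fintype V] [∀ v, Fintype (d v)]

theorem posSemidef_reducedState {ρ : Matrix (∀ v, d v) (∀ v, d v) ℂ} (h : ρ.PosSemidef)
    (R : Finset V) : (reducedState R ρ).PosSemidef := by
  have : reducedState R ρ = ∑ y, ρ.submatrix (fun x => glue R x y) (fun x => glue R x y) := by
    ext x x'
    simp [reducedState, Matrix.sum_apply]
  rw [this]
  exact posSemidef_sum _ fun y _ => h.submatrix _

theorem sum_reducedState_singleton (ρ : Matrix (∀ v, d v) (∀ v, d v) ℂ) (v : V) (g : d v → ℂ) :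
    ∑ x, g (x ⟨v, Finset.mem_singleton_self v⟩) * reducedState {v} ρ x x =
      ∑ z, g (z v) * ρ z z := by
  simp only [reducedState, Finset.mul_sum]
  rw [← Fintype.sum_prod_type']
  refine Fintype.sum_equiv (Equiv.piEquivPiSubtypeProd (fun w => w ∈ ({v} : Finset V)) d).symm _ _
    fun ⟨x, y⟩ => ?_
  have : glue {v} x y v = x ⟨v, Finset.mem_singleton_self v⟩ := by
    simp [glue, Equiv.piEquivPiSubtypeProd]
  change g (x ⟨v, _⟩) * _ = g (glue {v} x y v) * _
  rw [this]
  rfl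

variable [∀ v, DecidableEq (d v)]

theorem reducedState_catVector {c : Fin 2 → ∀ v, d v} (hc : ∀ v, c 0 v ≠ c 1 v) {R : Finset V}
    (hR : R ≠ Finset.univ) :
    reducedState R (pureState (catVector c)) = catMixture fun s (v : {v // v ∈ R}) => c s v.1 := by
  obtain ⟨v, hv⟩ : ∃ v, v ∉ R := by simpa [Finset.eq_univ_iff_forall] using hR
  ext x x'
  exact partialTrace_mixture (glue R) (q := fun s v => c s v.1) (fun s x y => glue_eq_iff R x y _)
    (fun h => hc v (congrFun h ⟨v, hv⟩)) x x'

theorem reducedState_catVector_of_eq_univ (c : Fin 2 → ∀ v, d v) {R : Finset V}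
    (hR : R = Finset.univ) : reducedState R (pureState (catVector c)) =
      pureState (catVector fun s (v : {v // v ∈ R}) => c s v.1) := by
  ext x x'
  refine partialTrace_pure (glue R) (q := fun s v => c s v.1) (fun s x y => glue_eq_iff R x y _)
    ?_ x x'
  ext v
  exact absurd (hR ▸ Finset.mem_univ v.1) v.2

theorem regionEntropy_catVector {c : Fin 2 → ∀ v, d v} (hc : ∀ v, c 0 v ≠ c 1 v) {R : Finset V}
    (hne : R.Nonempty) (hR : R ≠ Finset.univ) :
    regionEntropy (pureState (catVector c)) R = Real.log 2 := by
  obtain ⟨v, hv⟩ := hne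
  rw [regionEntropy, reducedState_catVector hc hR]
  exact vonNeumannEntropy_catMixture fun h => hc v (congrFun h ⟨v, hv⟩)

theorem regionEntropy_univ_catVector [Nonempty V] {c : Fin 2 → ∀ v, d v}
    (hc : ∀ v, c 0 v ≠ c 1 v) : regionEntropy (pureState (catVector c)) Finset.univ = 0 := by
  obtain ⟨v⟩ := ‹Nonempty V›
  rw [regionEntropy, reducedState_catVector_of_eq_univ c rfl]
  exact vonNeumannEntropy_pureState_catVector fun h => hc v (congrFun h ⟨v, Finset.mem_univ v⟩)

end Regions

/-! ### Regions of the GHZ state -/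

section GHZ

/-- The two configurations `0⋯0` and `1⋯1` of `k` parties that hold qubits. -/
def constConfig {V ι : Type*} (A : ι → Finset V) (s : Fin 2) :
    ∀ i, ∀ _ : {v // v ∈ A i}, Fin 2 :=
  fun _ _ => s

theorem ghzState_eq (n : ℕ) : ghzState n = pureState (catVector fun s _ => s) := rfl

theorem regionEntropy_ghzState {n : ℕ} {R : Finset (Fin n)} (hne : R.Nonempty)
    (hR : R ≠ Finset.univ) : regionEntropy (ghzState n) R = Real.log 2 := by
  rw [ghzState_eq]
  exact regionEntropy_catVector (fun _ => zero_ne_one) hne hR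

theorem regionEntropy_univ_ghzState {n : ℕ} [Nonempty (Fin n)] :
    regionEntropy (ghzState n) Finset.univ = 0 := by
  rw [ghzState_eq]
  exact regionEntropy_univ_catVector fun _ => zero_ne_one

/-- For disjoint regions the region chosen by `joinRegions` is the only one containing `v`. -/
theorem joinRegions_apply {V ι : Type*} [DecidableEq V] [Fintype ι]
    {d : V → Type*} {A : ι → Finset V} (hA : Pairwise fun i j => Disjoint (A i) (A j))
    (x : ∀ i, ∀ v : {v // v ∈ A i}, d v) {i : ι} {v : V} (hv : v ∈ A i)
    (h : v ∈ Finset.univ.biUnion A) : joinRegions A x ⟨v, h⟩ = x i ⟨v, hv⟩ := by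
  have key (j : ι) (hj : v ∈ A j) : x j ⟨v, hj⟩ = x i ⟨v, hv⟩ := by
    obtain rfl : j = i := by
      by_contra hne
      exact Finset.disjoint_left.1 (hA hne) hj hv
    rfl
  exact key _ _

theorem joinRegions_injective {V ι : Type*} [DecidableEq V] [Fintype ι]
    {d : V → Type*} {A : ι → Finset V} (hA : Pairwise fun i j => Disjoint (A i) (A j)) :
    Function.Injective (joinRegions A (d := d)) := by
  intro x x' h
  ext i ⟨v, hv⟩ : 2
  have hU : v ∈ Finset.univ.biUnion A := Finset.mem_biUnion.2 ⟨i, Finset.mem_univ i, hv⟩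
  rw [← joinRegions_apply hA x hv hU, ← joinRegions_apply hA x' hv hU, h]

variable {n : ℕ} {ι : Type*} [Fintype ι] {A : ι → Finset (Fin n)}

theorem multipartiteState_ghzState (hA : Pairwise fun i j => Disjoint (A i) (A j)) :
    multipartiteState (ghzState n) A = catMixture (constConfig A) ∨
      multipartiteState (ghzState n) A = pureState (catVector (constConfig A)) := by
  by_cases hU : Finset.univ.biUnion A = Finset.univ
  · right
    rw [← pureState_catVector_comp (constConfig A)
      (joinRegions_injective (d := fun _ => Fin 2) hA),
      multipartiteState, ghzState_eq, reducedState_catVector_of_eq_univ _ hU]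
    rfl
  · left
    rw [← catMixture_comp (constConfig A)
      (joinRegions_injective (d := fun _ => Fin 2) hA), multipartiteState,
      ghzState_eq, reducedState_catVector (fun _ => zero_ne_one) hU]
    rfl

end GHZ

/-! ### Purifications -/

section Purification

variable {ι : Type*} [Fintype ι] [DecidableEq ι]
  {H : ι → Type*}

/-- The configuration of parties with ancillas, as configurations of the parties and of the
ancillas. -/
def piProdEquiv (H K : ι → Type*) : (∀ i, H i × K i) ≃ (∀ i, H i) × (∀ i, K i) where
  toFun z := (fun i => (z i).1, fun i => (z i).2)
  invFun p i := (p.1 i, p.2 i)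
  left_inv _ := rfl
  right_inv _ := rfl

/-- A vector whose ancillas are in the configuration `g s` when the parties are in the
configuration `e s` purifies the mixture of the `e s` if `g 0 ≠ g 1`, and their superposition if
`g 0 = g 1`. -/
theorem isPurification_catVector [∀ i, DecidableEq (H i)] (e : Fin 2 → ∀ i, H i)
    {m : ι → ℕ} (g : Fin 2 → ∀ i, Fin (m i))
    {ρ : Matrix (∀ i, H i) (∀ i, H i) ℂ}
    (h : (g 0 ≠ g 1 ∧ ρ = catMixture e) ∨ (g 0 = g 1 ∧ ρ = pureState (catVector e))) :
    IsPurification ρ m (catVector fun s i => (e s i, g s i)) := by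
  intro x x'
  have hj (s : Fin 2) (x : ∀ i, H i) (a : ∀ i, Fin (m i)) :
      (fun i => (x i, a i)) = (fun i => (e s i, g s i)) ↔ x = e s ∧ a = g s := by
    simp [funext_iff, forall_and]
  rcases h with ⟨hg, rfl⟩ | ⟨hg, rfl⟩
  · exact partialTrace_mixture (fun (x : ∀ i, H i) (a : ∀ i, Fin (m i)) i => (x i, a i))
      (c := fun s i => (e s i, g s i)) hj hg x x'
  · exact partialTrace_pure (fun (x : ∀ i, H i) (a : ∀ i, Fin (m i)) i => (x i, a i))
      (c := fun s i => (e s i, g s i)) hj hg x x'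

/-- A purification has no amplitude where the diagonal of the state vanishes. -/
theorem eq_zero_of_isPurification {ρ : Matrix (∀ i, H i) (∀ i, H i) ℂ} {m : ι → ℕ}
    {ψ : (∀ i, H i × Fin (m i)) → ℂ} (hψ : IsPurification ρ m ψ) {z : ∀ i, H i × Fin (m i)}
    (hz : ρ (fun i => (z i).1) (fun i => (z i).1) = 0) : ψ z = 0 := by
  have h := hψ (fun i => (z i).1) (fun i => (z i).1)
  rw [hz] at h
  simp only [pureState, vecMulVec_apply, Pi.star_apply, Complex.star_def, Complex.mul_conj,
    ← Complex.ofReal_sum, Complex.ofReal_eq_zero] at h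
  rw [Finset.sum_eq_zero_iff_of_nonneg fun _ _ => Complex.normSq_nonneg _] at h
  exact Complex.normSq_eq_zero.1 (h (fun i => (z i).2) (Finset.mem_univ _))

variable [∀ i, Fintype (H i)]

/-- The diagonals of a state and of its purification give the same distribution of one party. -/
theorem sum_purification {ρ : Matrix (∀ i, H i) (∀ i, H i) ℂ} {m : ι → ℕ}
    {ψ : (∀ i, H i × Fin (m i)) → ℂ} (hψ : IsPurification ρ m ψ) (i : ι) (g : H i → ℂ) :
    ∑ z, g (z i).1 * pureState ψ z z = ∑ x, g (x i) * ρ x x := by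
  simp only [← hψ _ _, Finset.mul_sum]
  rw [← Fintype.sum_prod_type']
  exact Fintype.sum_equiv (piProdEquiv H fun i => Fin (m i)) _ _ fun _ => rfl

variable [∀ i, DecidableEq (H i)]

/-- Any purification of a state with the populations of a GHZ state gives each party, together with
its ancilla, an entropy of at least `ln 2`. -/
theorem log_two_le_regionEntropy_of_isPurification [Nontrivial ι] {e : Fin 2 → ∀ i, H i}
    (he : ∀ i, e 0 i ≠ e 1 i) {ρ : Matrix (∀ i, H i) (∀ i, H i) ℂ}
    (hρ : ∀ x, ρ x x = catMixture e x x) {m : ι → ℕ} {ψ : (∀ i, H i × Fin (m i)) → ℂ}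
    (hψ : IsPurification ρ m ψ) (i : ι) : Real.log 2 ≤ regionEntropy (pureState ψ) {i} := by
  have hpos : (reducedState {i} (pureState ψ)).PosSemidef :=
    posSemidef_reducedState (posSemidef_vecMulVec_self_star ψ) _
  -- The distribution of the system part of party `i` is uniform on `e 0 i` and `e 1 i`.
  have hsum (g : H i → ℂ) : ∑ x, g (x ⟨i, Finset.mem_singleton_self i⟩).1 *
      reducedState {i} (pureState ψ) x x = (g (e 0 i) + g (e 1 i)) / 2 := by
    rw [sum_reducedState_singleton (pureState ψ) i fun h => g h.1, sum_purification hψ]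
    simp only [hρ, catMixture, diagonal_apply_eq]
    simp only [Complex.ofReal_div, Complex.ofReal_add, apply_ite Complex.ofReal,
      Complex.ofReal_one, Complex.ofReal_zero, Complex.ofReal_ofNat]
    simp only [mul_div_assoc', ← Finset.sum_div, mul_add, Finset.sum_add_distrib, mul_ite, mul_one,
      mul_zero, Finset.sum_ite_eq', Finset.mem_univ, if_true]
  have hsupp (z : ∀ i, H i × Fin (m i)) (hz : ψ z ≠ 0) : ∃ s, ∀ j, (z j).1 = e s j := by
    by_contra! hne
    refine hz (eq_zero_of_isPurification hψ ?_)
    have h (s : Fin 2) : (fun j => (z j).1) ≠ e s := fun h =>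
      (hne s).elim fun j hj => hj (congrFun h j)
    simp [hρ, catMixture, h]
  rw [← neg_neg (Real.log 2), ← Real.log_inv]
  refine neg_log_le_vonNeumannEntropy hpos ?_ ?_
  · simpa [trace] using hsum 1
  refine eigenvalues_le_of_blockDiagonal hpos
    (fun x => (x ⟨i, Finset.mem_singleton_self i⟩).1) ?_ ?_
  · intro x x' hx
    refine Finset.sum_eq_zero fun y _ => ?_
    by_contra hne
    simp only [pureState, vecMulVec_apply, Pi.star_apply] at hne
    obtain ⟨s, hs⟩ := hsupp _ (left_ne_zero_of_mul hne)
    obtain ⟨s', hs'⟩ := hsupp _ (star_ne_zero.1 (right_ne_zero_of_mul hne))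
    -- A second party `j` sees the same bit in both configurations.
    obtain ⟨j, hj⟩ := exists_ne i
    have hj' : j ∉ ({i} : Finset ι) := by simpa using hj
    have hout (x : ∀ k : {k // k ∈ ({i} : Finset ι)}, H k × Fin (m k)) :
        glue (d := fun k => H k × Fin (m k)) {i} x y j = y ⟨j, hj'⟩ := by
      simp [glue, Equiv.piEquivPiSubtypeProd, hj]
    have hin (x : ∀ k : {k // k ∈ ({i} : Finset ι)}, H k × Fin (m k)) :
        glue (d := fun k => H k × Fin (m k)) {i} x y i = x ⟨i, Finset.mem_singleton_self i⟩ := by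
      simp [glue, Equiv.piEquivPiSubtypeProd]
    have hej : e s j = e s' j := by rw [← hs j, ← hs' j, hout, hout]
    have hss : s = s' := by
      have h01 := he j
      fin_cases s <;> fin_cases s' <;> first | rfl | exact absurd hej h01 | exact absurd hej.symm h01
    apply hx
    rw [← hin x, ← hin x', hs i, hs' i, hss]
  · intro h
    have := congrArg Complex.re (hsum fun k => if k = h then 1 else 0)
    simp only [ite_mul, one_mul, zero_mul, ← Finset.sum_filter, Complex.re_sum] at this
    rw [this]
    have h01 := he i
    by_cases h0 : e 0 i = h
    · have h1 : e 1 i ≠ h := fun h1 => h01 (h0.trans h1.symm)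
      simp [h0, h1]
    · by_cases h1 : e 1 i = h <;> simp [h0, h1]

/-- The entanglement of purification of disjoint non-empty regions of the GHZ state: each region
contributes `ln 2`. -/
theorem isLeast_purificationValues_ghzState {n : ℕ} [Nontrivial ι] {A : ι → Finset (Fin n)}
    (hne : ∀ i, (A i).Nonempty) (hA : Pairwise fun i j => Disjoint (A i) (A j)) :
    IsLeast (purificationValues (multipartiteState (ghzState n) A))
      (Fintype.card ι * Real.log 2) := by
  have he (i : ι) : constConfig A 0 i ≠ constConfig A 1 i := fun h =>
    zero_ne_one (congrFun h ⟨_, (hne i).choose_spec⟩)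
  obtain ⟨i₀⟩ : Nonempty ι := inferInstance
  constructor
  · obtain ⟨g, hg⟩ : ∃ g : Fin 2 → ι → Fin 2,
        IsPurification (multipartiteState (ghzState n) A) (fun _ => 2)
          (catVector fun s i => (constConfig A s i, g s i)) := by
      -- Qubit ancillas suffice: copies of the bit in the mixed case, constant in the pure case.
      rcases multipartiteState_ghzState hA with h | h
      · exact ⟨fun s _ => s, isPurification_catVector (m := fun _ => 2) _ _
          (.inl ⟨fun h => zero_ne_one (congrFun h i₀), h⟩)⟩
      · exact ⟨fun _ _ => 0, isPurification_catVector (m := fun _ => 2) _ _ (.inr ⟨rfl, h⟩)⟩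
    refine ⟨_, _, hg, ?_⟩
    have (i : ι) : regionEntropy
        (pureState (catVector fun s i => (constConfig A s i, g s i))) {i} = Real.log 2 := by
      refine regionEntropy_catVector (fun i h => he i (congrArg Prod.fst h))
        (Finset.singleton_nonempty i) fun h => ?_
      obtain ⟨j, hj⟩ := exists_ne i
      exact hj (Finset.mem_singleton.1 (h ▸ Finset.mem_univ j))
    simp [this]
  · rintro _ ⟨m, ψ, hψ, rfl⟩
    have hρ (x) : multipartiteState (ghzState n) A x x = catMixture (constConfig A) x x := by
      rcases multipartiteState_ghzState hA with h | h
      · rw [h]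
      · rw [h, pureState_catVector_diag fun h => he i₀ (congrFun h i₀)]
    calc Fintype.card ι * Real.log 2 = ∑ _i : ι, Real.log 2 := by simp
      _ ≤ _ := Finset.sum_le_sum fun i _ =>
        log_two_le_regionEntropy_of_isPurification he hρ hψ i

theorem isLeast_purificationValues_pair {n : ℕ} {A B : Finset (Fin n)} (hA : A.Nonempty)
    (hB : B.Nonempty) (hAB : Disjoint A B) :
    IsLeast (purificationValues (multipartiteState (ghzState n) ![A, B])) (2 * Real.log 2) := by
  have := isLeast_purificationValues_ghzState (A := ![A, B])
    (by simp [Fin.forall_fin_succ, hA, hB])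
    (by intro i j hij; fin_cases i <;> fin_cases j <;> simp_all [disjoint_comm])
  simpa using this

theorem isLeast_purificationValues_triple {n : ℕ} {A B C : Finset (Fin n)} (hA : A.Nonempty)
    (hB : B.Nonempty) (hC : C.Nonempty) (hAB : Disjoint A B) (hAC : Disjoint A C)
    (hBC : Disjoint B C) :
    IsLeast (purificationValues (multipartiteState (ghzState n) ![A, B, C]))
      (3 * Real.log 2) := by
  have := isLeast_purificationValues_ghzState (A := ![A, B, C])
    (by simp [Fin.forall_fin_succ, hA, hB, hC])
    (by intro i j hij; fin_cases i <;> fin_cases j <;> simp_all [disjoint_comm])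
  simpa using this

end Purification

end GHZPurification

open GHZPurification in
theorem mainTheorem3 (n : ℕ) (A B C : Finset (Fin n))
    (hA : A.Nonempty) (hB : B.Nonempty) (hC : C.Nonempty)
    (hAB : Disjoint A B) (hAC : Disjoint A C) (hBC : Disjoint B C) :
    -- the entropies
    (regionEntropy (ghzState n) A = Real.log 2 ∧
      regionEntropy (ghzState n) B = Real.log 2 ∧
      regionEntropy (ghzState n) C = Real.log 2 ∧
      regionEntropy (ghzState n) (A ∪ B) = Real.log 2 ∧
      regionEntropy (ghzState n) (B ∪ C) = Real.log 2 ∧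
      regionEntropy (ghzState n) (C ∪ A) = Real.log 2 ∧
      (A ∪ B ∪ C ≠ Finset.univ → regionEntropy (ghzState n) (A ∪ B ∪ C) = Real.log 2) ∧
      (A ∪ B ∪ C = Finset.univ → regionEntropy (ghzState n) (A ∪ B ∪ C) = 0)) ∧
    -- the upper and lower bounds on the tripartite quantity
    (min (min
        (regionEntropy (ghzState n) A + regionEntropy (ghzState n) B +
          regionEntropy (ghzState n) (A ∪ B))
        (regionEntropy (ghzState n) B + regionEntropy (ghzState n) C +
          regionEntropy (ghzState n) (B ∪ C)))
        (regionEntropy (ghzState n) A + regionEntropy (ghzState n) C +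
          regionEntropy (ghzState n) (A ∪ C)) = 3 * Real.log 2 ∧
      max
        (regionEntropy (ghzState n) A + regionEntropy (ghzState n) B +
          regionEntropy (ghzState n) C - regionEntropy (ghzState n) (A ∪ B ∪ C))
        (2 * (regionEntropy (ghzState n) A + regionEntropy (ghzState n) B +
            regionEntropy (ghzState n) C) -
          regionEntropy (ghzState n) (A ∪ B) - regionEntropy (ghzState n) (B ∪ C) -
          regionEntropy (ghzState n) (C ∪ A)) = 3 * Real.log 2) ∧
    -- the upper and lower bounds on the bipartite quantity
    (2 * min (regionEntropy (ghzState n) A) (regionEntropy (ghzState n) (B ∪ C)) =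
        2 * Real.log 2 ∧
      mutualInformation (ghzState n) A B + mutualInformation (ghzState n) A C =
        2 * Real.log 2) ∧
    -- the multipartite entanglement of purification, whose minimum is attained
    (IsLeast (purificationValues (multipartiteState (ghzState n) ![A, B, C]))
        (3 * Real.log 2) ∧
      IsLeast (purificationValues (multipartiteState (ghzState n) ![A, B ∪ C]))
        (2 * Real.log 2) ∧
      IsLeast (purificationValues (multipartiteState (ghzState n) ![B, A ∪ C]))
        (2 * Real.log 2) ∧
      IsLeast (purificationValues (multipartiteState (ghzState n) ![C, A ∪ B]))
        (2 * Real.log 2) ∧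
      Ep3 (ghzState n) A B C = 3 * Real.log 2 ∧
      Ep2 (ghzState n) A (B ∪ C) = 2 * Real.log 2 ∧
      Ep2 (ghzState n) B (A ∪ C) = 2 * Real.log 2 ∧
      Ep2 (ghzState n) C (A ∪ B) = 2 * Real.log 2) ∧
    -- the signal
    Delta3 (ghzState n) A B C = 0 := by

  have ne_univ {R S : Finset (Fin n)} (hS : S.Nonempty) (h : Disjoint R S) :
      R ≠ Finset.univ := by
    rintro rfl
    obtain ⟨v, hv⟩ := hS
    exact Finset.disjoint_left.1 h (Finset.mem_univ v) hv
  have sA := regionEntropy_ghzState hA (ne_univ hB hAB)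
  have sB := regionEntropy_ghzState hB (ne_univ hC hBC)
  have sC := regionEntropy_ghzState hC (ne_univ hA hAC.symm)
  have sAB := regionEntropy_ghzState (hA.inl (t := B))
    (ne_univ hC (Finset.disjoint_union_left.2 ⟨hAC, hBC⟩))
  have sBC := regionEntropy_ghzState (hB.inl (t := C))
    (ne_univ hA (Finset.disjoint_union_left.2 ⟨hAB.symm, hAC.symm⟩))
  have sCA := regionEntropy_ghzState (hC.inl (t := A))
    (ne_univ hB (Finset.disjoint_union_left.2 ⟨hBC.symm, hAB⟩))
  have sAC : regionEntropy (ghzState n) (A ∪ C) = Real.log 2 := Finset.union_comm C A ▸ sCA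
  have sABC : regionEntropy (ghzState n) (A ∪ B ∪ C) = Real.log 2 ∨
      regionEntropy (ghzState n) (A ∪ B ∪ C) = 0 := by
    by_cases h : A ∪ B ∪ C = Finset.univ
    · have : Nonempty (Fin n) := ⟨hA.choose⟩
      exact .inr (h ▸ regionEntropy_univ_ghzState)
    · exact .inl (regionEntropy_ghzState hA.inl.inl h)
  have e3 := isLeast_purificationValues_triple hA hB hC hAB hAC hBC
  have eA := isLeast_purificationValues_pair hA (hB.inl (t := C))
    (Finset.disjoint_union_right.2 ⟨hAB, hAC⟩)
  have eB := isLeast_purificationValues_pair hB (hA.inl (t := C))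
    (Finset.disjoint_union_right.2 ⟨hAB.symm, hBC⟩)
  have eC := isLeast_purificationValues_pair hC (hA.inl (t := B))
    (Finset.disjoint_union_right.2 ⟨hAC.symm, hBC.symm⟩)
  have hlog : 0 < Real.log 2 := Real.log_pos one_lt_two
  have v3 : Ep3 (ghzState n) A B C = 3 * Real.log 2 := e3.csInf_eq
  have vA : Ep2 (ghzState n) A (B ∪ C) = 2 * Real.log 2 := eA.csInf_eq
  have vB : Ep2 (ghzState n) B (A ∪ C) = 2 * Real.log 2 := eB.csInf_eq
  have vC : Ep2 (ghzState n) C (A ∪ B) = 2 * Real.log 2 := eC.csInf_eq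
  refine ⟨⟨sA, sB, sC, sAB, sBC, sCA, regionEntropy_ghzState hA.inl.inl, fun h => ?_⟩, ⟨?_, ?_⟩,
    ⟨?_, ?_⟩, ⟨e3, eA, eB, eC, v3, vA, vB, vC⟩, ?_⟩
  · have : Nonempty (Fin n) := ⟨hA.choose⟩
    rw [h, regionEntropy_univ_ghzState]
  · rw [sA, sB, sC, sAB, sBC, sAC, min_self, min_self]
    ring
  · rw [sA, sB, sC, sAB, sBC, sCA, max_eq_right]
    · ring
    · rcases sABC with h | h <;> rw [h] <;> linarith
  · rw [sA, sBC, min_self]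
  · rw [mutualInformation, mutualInformation, sA, sB, sC, sAB, sAC]
    ring
  · rw [Delta3, v3, vA, vB, vC]
    ring
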